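/- **Theorem 1.1.** Work in ZFC and assume Jensen's principle $\diamondsuit$: there is a sequence $\{S_\alpha\}_{\alpha<\omega_1}$ with $S_\alpha\subseteq\alpha$ such that for every $J\subseteq\omega_1$ the set $\{\alpha<\omega_1 \mid J\cap\alpha=S_\alpha\}$ is stationary in $\omega_1$ (that is, it meets every closed unbounded subset of $\omega_1$). Then there exists a topological space $X$, having a basis $\mathcal{B}$, which is 1. regular (which includes Hausdorff); 2. separable; 3. connected; 4. of cardinality $\aleph_1$; and such that 5. for every nonempty open $O\subseteq X$ the subspace $X\setminus O$ is totally separated, i.e. for any distinct $x,y\in X\setminus O$ there are disjoint relatively open sets $V_0\ni x$ and $V_1\ni y$ in $X\setminus O$ with $X\setminus O=V_0\cup V_1$ (hence $X\setminus O$ is totally disconnected); 6. every nonempty open $O\subseteq X$ is uncountable; 7. $|\mathcal{B}|=\aleph_1$; 8. every countable cover of $X$ by elements of $\mathcal{B}$ has a finite subcover; and 9. every decreasing sequence $B_0\supseteq B_1\supseteq B_2\supseteq\cdots$ of elements of $\mathcal{B}$ has $\bigcap_{n\in\omega}B_n\neq\emptyset$ (hence $X$ is strongly Choquet). Here $X$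 is *strongly Choquet* if Player II has a winning strategy in the following game. In round $n=0,1,2,\dots$ Player I plays a point $x_n$ and an open set $U_n\ni x_n$, with $U_n\subseteq V_{n-1}$ if $n\geq 1$, and Player II answers with an open set $V_n$ with $x_n\in V_n\subseteq U_n$. Player II wins the run if $\bigcap_{n\in\omega}U_n\neq\emptyset$, and otherwise Player I wins. -/

import Mathlib

open scoped Cardinal Ordinal

/-- The ordinal `ω₁`, that is, the set of all countable ordinals, as a well-ordered type. -/
abbrev OmegaOne : Type := (ω₁ : Ordinal.{0}).ToType

/-- Jensen's principle `◇`: there is a sequence of sets `S α ⊆ α`, for `α < ω₁`, such that for every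
`J ⊆ ω₁` the set of all `α < ω₁` with `J ∩ α = S α` is stationary in `ω₁`. The ordinal `α`, as the
set of its predecessors, is `Set.Iio α`. -/
def Diamond : Prop :=
  ∃ S : OmegaOne → Set OmegaOne,
    (∀ α, S α ⊆ Set.Iio α) ∧
    ∀ J : Set OmegaOne, IsStationary {α : OmegaOne | J ∩ Set.Iio α = S α}

namespace StrongChoquetGame

variable {X : Type*} [TopologicalSpace X]

/-- In round `n` of the strong Choquet game, Player I plays a pair `p n = (x, U)` of a point and a set,
and Player II answers with a set. A strategy for Player II assigns an answer to each finite list of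
moves of Player I (the earlier answers of Player II are determined by these moves). This is the
answer in round `n` when Player II follows the strategy `σ`. -/
def answer (σ : List (X × Set X) → Set X) (p : ℕ → X × Set X) (n : ℕ) : Set X :=
  σ ((List.range (n + 1)).map p)

/-- The move `p n = (x, U)` of Player I obeys the rules: `U` is open, `x ∈ U`, and `U` is contained in
the previous answer of Player II, if there is one. -/
def LegalMove (σ : List (X × Set X) → Set X) (p : ℕ → X × Set X) (n : ℕ) : Prop :=
  IsOpen (p n).2 ∧ (p n).1 ∈ (p n).2 ∧ ∀ k, k + 1 = n → (p n).2 ⊆ answer σ p k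

/-- The answer `V` of Player II to the move `p n = (x, U)` obeys the rules: `V` is open and
`x ∈ V ⊆ U`. -/
def LegalAnswer (σ : List (X × Set X) → Set X) (p : ℕ → X × Set X) (n : ℕ) : Prop :=
  IsOpen (answer σ p n) ∧ (p n).1 ∈ answer σ p n ∧ answer σ p n ⊆ (p n).2

/-- `σ` is a winning strategy for Player II: as long as Player I obeys the rules, `σ` gives legal
answers, and in every infinite run in which Player I obeys the rules, the sets played by Player I
have a common point. -/
def IsWinning (σ : List (X × Set X) → Set X) : Prop :=
  ∀ p : ℕ → X × Set X,
    (∀ n, (∀ k ≤ n, LegalMove σ p k) → LegalAnswer σ p n) ∧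
    ((∀ n, LegalMove σ p n) → (⋂ n, (p n).2).Nonempty)

end StrongChoquetGame

/-- A space is strongly Choquet if Player II has a winning strategy in the strong Choquet game. -/
def StronglyChoquet (X : Type*) [TopologicalSpace X] : Prop :=
  ∃ σ : List (X × Set X) → Set X, StrongChoquetGame.IsWinning σ

/-! ### Countable ordinals -/

/-! The space lies in [0,1] × ℝ^ω₁, and ◇ enters only through CH. A code is a position in [0,1] with
a sign for each α < ω₁. Its coordinate at stage α is ± its distance from a chosen centre, measured
in the position and finitely many earlier coordinates. So each stage doubles the space and glues the
two copies where this distance vanishes. Flipping the sign at the centre does not move the point,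
hence the compact space of all coded points is connected (`isPreconnected_range_embed`). Outside a
basic neighbourhood of the centre the coordinate is nonzero, so its sign gives a clopen partition
(`totallySeparatedSpace_compl`).

X keeps only ℵ₁ codes, which realize every countable initial part (`IsFull`); CH makes this
possible. Closed conditions on countably many coordinates that have a solution in the compact space
have one in X. This gives a form of countable compactness (`IsFull.inter_iInter_nonempty`) and, with
a countable dense set, connectedness (`IsFull.isPreconnected_points`). The signs not prescribed by
an initial part are free, and bookkeeping uses them to separate every pair of points outside every
basic neighbourhood of a dense point (`PointIndex.exists_separating`).

The basis consists of balls whose radii are chosen by recursion (`exists_radii`): a ball inside an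
earlier one has its closed ball there too. A decreasing sequence of balls then has a subsequence
with increasing indices, where compactness applies, or one whose indices are eventually constant. -/

theorem mk_omegaOne : #OmegaOne = ℵ₁ := by
  simp [OmegaOne, Cardinal.mk_toType]

theorem OmegaOne.countable_Iio (α : OmegaOne) : (Set.Iio α).Countable := by
  rw [← Cardinal.le_aleph0_iff_set_countable, ← Order.lt_succ_iff, Cardinal.succ_aleph0,
    ← mk_omegaOne]
  exact Cardinal.mk_Iio_lt _ (by simp [OmegaOne])

theorem OmegaOne.countable_Iic (α : OmegaOne) : (Set.Iic α).Countable := by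
  rw [← Set.Iio_union_right]
  exact (countable_Iio α).union (Set.countable_singleton α)

instance : Uncountable OmegaOne := by
  rw [← Cardinal.aleph0_lt_mk_iff, mk_omegaOne]
  exact Cardinal.aleph0_lt_aleph_one

theorem OmegaOne.exists_forall_lt {s : Set OmegaOne} (hs : s.Countable) : ∃ α, ∀ β ∈ s, β < α := by
  by_contra! h
  refine Set.not_countable_univ (α := OmegaOne) ((hs.biUnion fun β _ => countable_Iic β).mono ?_)
  intro α _
  obtain ⟨β, hβ, h⟩ := h α
  exact Set.mem_biUnion hβ h

theorem OmegaOne.isClub_forall_lt (f : ℕ → OmegaOne) : IsClub {α | ∀ n, f n < α} := by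
  refine ⟨?_, fun a => ?_⟩
  · intro t ht ht₀ _ a ha n
    obtain ⟨b, hb⟩ := ht₀
    exact (ht hb n).trans_le (ha.1 hb)
  · obtain ⟨α, h⟩ := exists_forall_lt ((Set.countable_range f).union (Set.countable_singleton a))
    exact ⟨α, fun n => h _ (Or.inl ⟨n, rfl⟩), (h a (Or.inr rfl)).le⟩

/-- Jensen's principle implies the continuum hypothesis. -/
theorem Diamond.continuum_eq (h : Diamond) : (𝔠 : Cardinal.{0}) = ℵ₁ := by
  refine le_antisymm ?_ Cardinal.aleph_one_le_continuum
  obtain ⟨S, -, hS⟩ := h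
  let f := Infinite.natEmbedding OmegaOne
  have hsurj : Function.Surjective fun α => f ⁻¹' (S α) := by
    intro A
    -- Above the whole range of `f`, cutting `f '' A` at `α` loses nothing, so the guess `S α`
    -- determines `A`.
    obtain ⟨α, hα, hfα⟩ := hS (f '' A) (OmegaOne.isClub_forall_lt f)
    refine ⟨α, ?_⟩
    have hα : f '' A ∩ Set.Iio α = S α := hα
    ext n
    simp only [← hα, Set.mem_preimage, Set.mem_inter_iff, Set.mem_Iio, hfα n, and_true]
    exact f.injective.mem_set_image
  simpa [mk_omegaOne] using Cardinal.mk_le_of_surjective hsurj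

/-- A function chosen by well-founded recursion, each value against all earlier ones. -/
theorem exists_forall_lt_of_forall_exists {I α : Type*} [LinearOrder I] [WellFoundedLT I]
    [Nonempty α] {p : I → α → Prop} {R : I → α → I → α → Prop}
    (h : ∀ i (f : I → α), ∃ y, p i y ∧ ∀ j < i, R i y j (f j)) :
    ∃ f : I → α, ∀ i, p i (f i) ∧ ∀ j < i, R i (f i) j (f j) := by
  classical
  choose y hy using h
  let f : I → α := (wellFounded_lt (α := I)).fix fun i rec =>
    y i fun j => if hj : j < i then rec j hj else Classical.arbitrary α
  refine ⟨f, fun i => ?_⟩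
  have hf : f i = y i fun j => if j < i then f j else Classical.arbitrary α := by
    simp only [f]
    rw [WellFounded.fix_eq]
    simp
  rw [hf]
  refine ⟨(hy i _).1, fun j hj => ?_⟩
  have := (hy i fun j => if j < i then f j else Classical.arbitrary α).2 j hj
  simpa only [if_pos hj] using this

open Topology Filter

/-! ### Radial functions on a product -/

section Radial

variable {I : Type*}

/-- The distance of two points of `[0,1] × ℝ^I`, measured on the first factor and on the coordinates
in a finite set. -/
noncomputable def radial (G : Finset I) (a z : unitInterval × (I → ℝ)) : ℝ :=
  dist z.1 a.1 + ∑ i ∈ G, dist (z.2 i) (a.2 i)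

theorem continuous_radial (G : Finset I) (a : unitInterval × (I → ℝ)) :
    Continuous (radial G a) := by
  unfold radial
  fun_prop

theorem radial_nonneg (G : Finset I) (a z : unitInterval × (I → ℝ)) : 0 ≤ radial G a z :=
  add_nonneg dist_nonneg (Finset.sum_nonneg fun _ _ => dist_nonneg)

@[simp]
theorem radial_self (G : Finset I) (a : unitInterval × (I → ℝ)) : radial G a a = 0 := by
  simp [radial]

theorem radial_congr {G : Finset I} {a z z' : unitInterval × (I → ℝ)} (h₁ : z.1 = z'.1)
    (h₂ : ∀ i ∈ G, z.2 i = z'.2 i) : radial G a z = radial G a z' := by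
  unfold radial
  rw [h₁, Finset.sum_congr rfl fun i hi => by rw [h₂ i hi]]

theorem exists_radial_lt_subset {a : unitInterval × (I → ℝ)} {O : Set (unitInterval × (I → ℝ))}
    (hO : O ∈ 𝓝 a) : ∃ (G : Finset I) (ε : ℝ), 0 < ε ∧ {z | radial G a z < ε} ⊆ O := by
  obtain ⟨u, hu, v, hv, huv⟩ := mem_nhds_prod_iff.1 hO
  obtain ⟨ε₂, hε₂, hu⟩ := Metric.mem_nhds_iff.1 hu
  rw [nhds_pi, Filter.mem_pi'] at hv
  obtain ⟨G, t, ht, hv⟩ := hv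
  choose δ hδ hδt using fun i => Metric.mem_nhds_iff.1 (ht i)
  obtain ⟨ε₁, hε₁, hle⟩ : ∃ ε₁ > 0, ∀ i ∈ G, ε₁ ≤ δ i := by
    rcases G.eq_empty_or_nonempty with rfl | hG
    · exact ⟨1, one_pos, by simp⟩
    · exact ⟨G.inf' hG δ, (Finset.lt_inf'_iff hG).2 fun i _ => hδ i,
        fun i hi => Finset.inf'_le _ hi⟩
  refine ⟨G, min ε₂ ε₁, lt_min hε₂ hε₁, fun z hz => huv ⟨hu ?_, hv fun i hi => hδt i ?_⟩⟩
  · have := Finset.sum_nonneg (s := G) fun i _ => dist_nonneg (x := z.2 i) (y := a.2 i)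
    have hz : dist z.1 a.1 + ∑ i ∈ G, dist (z.2 i) (a.2 i) < min ε₂ ε₁ := hz
    have := min_le_left ε₂ ε₁
    rw [Metric.mem_ball]
    linarith
  · have := Finset.single_le_sum (s := G) (fun i _ => dist_nonneg (x := z.2 i) (y := a.2 i)) hi
    have hz : dist z.1 a.1 + ∑ i ∈ G, dist (z.2 i) (a.2 i) < min ε₂ ε₁ := hz
    have := min_le_right ε₂ ε₁
    have := hle i hi
    have := dist_nonneg (x := z.1) (y := a.1)
    rw [Metric.mem_ball]
    linarith

end Radial

/-! ### Iterated doubling of an interval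

A code consists of a point of the unit interval and a sequence of signs. At each stage the space
constructed so far is doubled along the zero set of a radial function, and the sign tells to which of
the two copies the point goes. -/

section Doubling

variable {I : Type*} [LinearOrder I]

/-- The coordinate at stage `α` of the point with code `c`. -/
noncomputable def coord [WellFoundedLT I] (d : I → unitInterval × (I → Bool)) (F : I → Finset I)
    (α : I) (c : unitInterval × (I → Bool)) : ℝ :=
  (if c.2 α then 1 else -1) * (dist c.1 (d α).1 +
    ∑ i ∈ ((F α).filter (· < α)).attach, dist (coord d F i.1 c) (coord d F i.1 (d α)))
termination_by (wellFounded_lt (α := I)).wrap α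
decreasing_by all_goals exact (Finset.mem_filter.1 i.2).2

variable [WellFoundedLT I] (d : I → unitInterval × (I → Bool)) (F : I → Finset I)

/-- The point with code `c`. -/
noncomputable def embed (c : unitInterval × (I → Bool)) : unitInterval × (I → ℝ) :=
  (c.1, fun α => coord d F α c)

/-- The absolute value of the coordinate at stage `α`. -/
noncomputable def gap (α : I) (c : unitInterval × (I → Bool)) : ℝ :=
  radial ((F α).filter (· < α)) (embed d F (d α)) (embed d F c)

theorem coord_eq (α : I) (c : unitInterval × (I → Bool)) :
    coord d F α c = (if c.2 α then 1 else -1) * gap d F α c := by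
  rw [coord, Finset.sum_attach _ fun i => dist (coord d F i c) (coord d F i (d α))]
  rfl

theorem gap_nonneg (α : I) (c : unitInterval × (I → Bool)) : 0 ≤ gap d F α c :=
  radial_nonneg _ _ _

variable {d F} in
-- By induction, a coordinate depends continuously on the position, the earlier coordinates and its
-- own sign. The two alternatives are mixed because where a gap vanishes the coordinate can converge
-- while the sign does not.
theorem tendsto_coord {J : Type*} {l : Filter J} {e : J → unitInterval × (I → Bool)}
    {c : unitInterval × (I → Bool)} {α : I} (h₁ : Tendsto (fun j => (e j).1) l (𝓝 c.1))
    (h₂ : ∀ β ≤ α, Tendsto (fun j => coord d F β (e j)) l (𝓝 (coord d F β c)) ∨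
      ∀ᶠ j in l, (e j).2 β = c.2 β) :
    Tendsto (fun j => coord d F α (e j)) l (𝓝 (coord d F α c)) := by
  induction α using WellFoundedLT.induction with
  | ind α ih =>
    rcases h₂ α le_rfl with h | h
    · exact h
    · have hgap : Tendsto (fun j => gap d F α (e j)) l (𝓝 (gap d F α c)) := by
        refine (h₁.dist tendsto_const_nhds).add (tendsto_finsetSum _ fun i hi => ?_)
        have hi : i < α := (Finset.mem_filter.1 hi).2
        exact (ih i hi fun β hβ => h₂ β (hβ.trans hi.le)).dist tendsto_const_nhds
      simp only [coord_eq]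
      refine Tendsto.mul (tendsto_const_nhds.congr' ?_) hgap
      filter_upwards [h] with j hj
      rw [hj]

theorem continuous_coord (α : I) : Continuous (coord d F α) := by
  refine continuous_iff_continuousAt.2 fun c => tendsto_coord (continuous_fst.tendsto c)
    fun β _ => Or.inr ?_
  have : Tendsto (fun c : unitInterval × (I → Bool) => c.2 β) (𝓝 c) (𝓝 (c.2 β)) :=
    Continuous.tendsto (by fun_prop) c
  exact this.eventually_mem (isOpen_discrete {c.2 β} |>.mem_nhds rfl)

theorem continuous_embed : Continuous (embed d F) :=
  continuous_fst.prodMk (continuous_pi fun α => continuous_coord d F α)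

variable {d F} in
theorem coord_congr {α : I} {c c' : unitInterval × (I → Bool)} (h₁ : c.1 = c'.1)
    (h₂ : ∀ β ≤ α, c.2 β = c'.2 β) : coord d F α c = coord d F α c' := by
  -- Convergence along the principal filter of a point is equality.
  have := tendsto_coord (d := d) (F := F) (l := pure ()) (e := fun _ : Unit => c) (c := c') (α := α)
    (by rw [h₁]; exact tendsto_const_nhds) (fun β hβ => Or.inr (by simp [h₂ β hβ]))
  exact tendsto_nhds_unique tendsto_const_nhds this

variable {d F} in
theorem gap_congr {α : I} {c c' : unitInterval × (I → Bool)} (h₁ : c.1 = c'.1)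
    (h₂ : ∀ β < α, c.2 β = c'.2 β) : gap d F α c = gap d F α c' := by
  refine radial_congr h₁ fun i hi => coord_congr h₁ fun β hβ => h₂ β (hβ.trans_lt ?_)
  exact (Finset.mem_filter.1 hi).2

variable {d F} in
-- At stage `α` both signs give 0, and later stages see the values of earlier coordinates, not their
-- signs.
theorem embed_eq_of_gap_eq_zero {α : I} {c c' : unitInterval × (I → Bool)} (h₁ : c.1 = c'.1)
    (h₂ : ∀ β ≠ α, c.2 β = c'.2 β) (h : gap d F α c = 0) : embed d F c = embed d F c' := by
  have hc' : gap d F α c' = 0 := by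
    rw [← h]
    exact gap_congr h₁.symm fun β hβ => (h₂ β hβ.ne).symm
  refine Prod.ext h₁ (funext fun β => ?_)
  have := tendsto_coord (d := d) (F := F) (l := pure ()) (e := fun _ : Unit => c) (c := c') (α := β)
    (by rw [h₁]; exact tendsto_const_nhds) (fun γ _ => ?_)
  · exact tendsto_nhds_unique tendsto_const_nhds this
  · by_cases hγ : γ = α
    · left
      rw [hγ, coord_eq d F α c, coord_eq d F α c', h, hc', mul_zero, mul_zero]
      exact tendsto_const_nhds
    · right
      simp [h₂ γ hγ]

/-- A continuous two-valued function of sign sequences that is invariant under changes of a single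
sign in `T` is invariant under all changes in `T`. -/
theorem eq_of_forall_update_eq {I : Type*} [DecidableEq I] {u : (I → Bool) → Bool}
    (hu : Continuous u) {T : Set I} (h : ∀ β ∈ T, ∀ s b, u (Function.update s β b) = u s)
    {s s' : I → Bool} (hs : ∀ β ∉ T, s β = s' β) : u s = u s' := by
  classical
  have hfin : ∀ G : Finset I, u (G.piecewise s' s) = u s := by
    intro G
    induction G using Finset.induction_on with
    | empty => simp
    | insert a G _ ih =>
      rw [Finset.piecewise_insert]
      by_cases ha : a ∈ T
      · rw [h a ha, ih]
      · rw [← ih]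
        congr 1
        rw [Function.update_eq_self_iff]
        simp [Finset.piecewise, hs a ha]
  have hlim : Tendsto (fun G : Finset I => G.piecewise s' s) atTop (𝓝 s') := by
    refine tendsto_pi_nhds.2 fun i => tendsto_const_nhds.congr' ?_
    filter_upwards [eventually_ge_atTop {i}] with G hG
    rw [Finset.piecewise_eq_of_mem _ _ _ (hG (Finset.mem_singleton_self i))]
  have := (hu.tendsto s').comp hlim
  simp only [Function.comp_def, hfin] at this
  exact tendsto_nhds_unique tendsto_const_nhds this

/-- A continuous two-valued function, pulled back to codes, ignores the position because the
interval is connected. By induction on the stage it ignores every single sign, hence by continuity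
all of them. -/
theorem isPreconnected_range_embed : IsPreconnected (Set.range (embed d F)) := by
  classical
  rw [isPreconnected_iff_preconnectedSpace]
  refine preconnectedSpace_of_forall_constant fun f hf => ?_
  let w : unitInterval × (I → Bool) → Bool := fun c => f ⟨embed d F c, c, rfl⟩
  have hw : Continuous w := hf.comp ((continuous_embed d F).subtype_mk _)
  have hw_congr : ∀ c c', embed d F c = embed d F c' → w c = w c' := fun c c' h => by
    simp only [w, h]
  have hw_fst : ∀ t t' s, w (t, s) = w (t', s) := fun t t' s =>
    PreconnectedSpace.constant inferInstance
      (f := fun t : unitInterval => w (t, s)) (by fun_prop)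
  have hu : Continuous fun s => w (0, s) := by fun_prop
  have hflip : ∀ β, ∀ s b, w (0, Function.update s β b) = w (0, s) := by
    intro β
    induction β using WellFoundedLT.induction with
    | ind β ih =>
      intro s b
      -- The induction hypothesis allows moving the signs before `β` to those of the centre `d β`;
      -- over the position of `d β` the gap then vanishes and the flip is invisible.
      let s₁ : I → Bool := fun i => if i < β then (d β).2 i else s i
      have h₁ : w (0, s) = w (0, s₁) :=
        eq_of_forall_update_eq hu (T := Set.Iio β) ih fun i hi => by
          simp only [s₁, if_neg (show ¬ i < β from hi)]
      have h₂ : w (0, Function.update s β b) = w (0, Function.update s₁ β b) :=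
        eq_of_forall_update_eq hu (T := Set.Iio β) ih fun i hi => by
          simp only [s₁, Function.update_apply, if_neg (show ¬ i < β from hi)]
      rw [h₁, h₂, hw_fst 0 (d β).1, hw_fst 0 (d β).1]
      refine (hw_congr ((d β).1, s₁) (_, Function.update s₁ β b) (embed_eq_of_gap_eq_zero (α := β) rfl
        (fun i hi => (Function.update_of_ne hi _ _).symm) ?_)).symm
      rw [gap_congr (c := ((d β).1, s₁)) (c' := d β) rfl fun i hi => by simp [s₁, hi]]
      exact radial_self _ _
  rintro ⟨_, c, rfl⟩ ⟨_, c', rfl⟩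
  change w c = w c'
  rw [← Prod.mk.eta (p := c), ← Prod.mk.eta (p := c'), hw_fst c.1 0, hw_fst c'.1 0]
  exact eq_of_forall_update_eq hu (T := Set.univ) (fun β _ => hflip β) (by simp)

variable {d F} in
/-- The projection of the space to its first stages is open, stated for closures. -/
theorem embed_mem_closure {W : Set (unitInterval × (I → ℝ))} {α : I}
    (hW : ∀ z z', z.1 = z'.1 → (∀ i < α, z.2 i = z'.2 i) → z ∈ W → z' ∈ W)
    {c c' : unitInterval × (I → Bool)} (h₁ : c'.1 = c.1)
    (h₂ : ∀ i < α, coord d F i c' = coord d F i c)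
    (hc : embed d F c ∈ closure (W ∩ Set.range (embed d F))) :
    embed d F c' ∈ closure (W ∩ Set.range (embed d F)) := by
  -- Along `l`, coded points in `W` approach the point of `c`. Grafting the signs of `c'` from `α`
  -- on keeps them in `W` and moves the limit to the point of `c'`.
  let l := comap (embed d F) (𝓝 (embed d F c)) ⊓ 𝓟 (embed d F ⁻¹' W)
  have hl : NeBot l := by
    refine inf_principal_neBot_iff.2 fun A hA => ?_
    obtain ⟨O, hO, hOA⟩ := mem_comap.1 hA
    obtain ⟨_, hzO, hzW, e, rfl⟩ := mem_closure_iff_nhds.1 hc O hO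
    exact ⟨e, hOA hzO, hzW⟩
  have hle : Tendsto (embed d F) l (𝓝 (embed d F c)) := tendsto_comap.mono_left inf_le_left
  let φ : unitInterval × (I → Bool) → unitInterval × (I → Bool) :=
    fun e => (e.1, fun i => if i < α then e.2 i else c'.2 i)
  have hφ : ∀ e, ∀ i < α, coord d F i (φ e) = coord d F i e := fun e i hi =>
    coord_congr rfl fun β hβ => by simp [φ, hβ.trans_lt hi]
  have h_fst : Tendsto (fun e => (φ e).1) l (𝓝 c'.1) := by
    rw [h₁]
    exact (continuous_fst.tendsto (embed d F c)).comp hle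
  refine mem_closure_of_tendsto (b := l) (f := fun e => embed d F (φ e)) ?_ ?_
  · refine h_fst.prodMk_nhds (tendsto_pi_nhds.2 fun β => tendsto_coord h_fst fun γ _ => ?_)
    by_cases hγ : γ < α
    · left
      simp only [hφ _ γ hγ, h₂ γ hγ]
      exact (((continuous_apply γ).comp continuous_snd).tendsto (embed d F c)).comp hle
    · right
      simp [φ, hγ]
  · have : ∀ᶠ e in l, embed d F e ∈ W := mem_inf_of_right (mem_principal_self _)
    filter_upwards [this] with e he
    exact ⟨hW (embed d F e) _ rfl (fun i hi => (hφ e i hi).symm) he, _, rfl⟩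

end Doubling

/-! ### Sets that depend on countably many coordinates -/

/-- Membership in `W` is decided by the first factor and the coordinates before `α`. -/
def DependsBelow {I : Type*} [LT I] (α : I) (W : Set (unitInterval × (I → ℝ))) : Prop :=
  ∀ z z', z.1 = z'.1 → (∀ i < α, z.2 i = z'.2 i) → z ∈ W → z' ∈ W

theorem dependsBelow_radial {I : Type*} [LT I] {α : I} {G : Finset I} (hG : ∀ i ∈ G, i < α)
    (a : unitInterval × (I → ℝ)) (T : Set ℝ) : DependsBelow α (radial G a ⁻¹' T) := by
  intro z z' h₁ h₂ hz
  rwa [Set.mem_preimage, ← radial_congr h₁ fun i hi => h₂ i (hG i hi)]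

theorem exists_forall_finset_lt {J : Type*} [Countable J] (G : J → Finset OmegaOne) :
    ∃ α, ∀ j, ∀ i ∈ G j, i < α := by
  obtain ⟨α, hα⟩ := OmegaOne.exists_forall_lt
    (Set.countable_iUnion fun j => (G j).countable_toSet)
  exact ⟨α, fun j i hi => hα i (Set.mem_iUnion.2 ⟨j, hi⟩)⟩

/-! ### The subspace given by a full family of codes -/

section Full

variable {P : Type*} {d : OmegaOne → unitInterval × (OmegaOne → Bool)}
  {F : OmegaOne → Finset OmegaOne} {S : P → unitInterval × (OmegaOne → Bool)}

/-- Every countable initial part of a code is realized in the family `S`. -/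
def IsFull (S : P → unitInterval × (OmegaOne → Bool)) : Prop :=
  ∀ (α : OmegaOne) (c : unitInterval × (OmegaOne → Bool)), ∃ p, (S p).1 = c.1 ∧ ∀ i < α, (S p).2 i = c.2 i

variable (d F S) in
/-- The space of all points with a code in the family `S`. -/
def points : Set (unitInterval × (OmegaOne → ℝ)) :=
  Set.range fun p => embed d F (S p)

theorem IsFull.exists_eq (hS : IsFull S) (α : OmegaOne) (c : unitInterval × (OmegaOne → Bool)) :
    ∃ p, (S p).1 = c.1 ∧ ∀ i < α, coord d F i (S p) = coord d F i c := by
  obtain ⟨p, h₁, h₂⟩ := hS α c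
  exact ⟨p, h₁, fun i hi => coord_congr h₁ fun β hβ => h₂ β (hβ.trans_lt hi)⟩

theorem IsFull.exists_mem (hS : IsFull S) {α : OmegaOne}
    {W : Set (unitInterval × (OmegaOne → ℝ))} (hW : DependsBelow α W)
    {c : unitInterval × (OmegaOne → Bool)} (hc : embed d F c ∈ W) :
    ∃ p, (S p).1 = c.1 ∧ embed d F (S p) ∈ W := by
  obtain ⟨p, h₁, h₂⟩ := hS.exists_eq (d := d) (F := F) α c
  exact ⟨p, h₁, hW _ _ h₁.symm (fun i hi => (h₂ i hi).symm) hc⟩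

/-- Countable compactness with respect to closed sets that depend on countably many coordinates. -/
theorem IsFull.inter_iInter_nonempty (hS : IsFull S) {J : Type*} {α : OmegaOne}
    {L : J → Set (unitInterval × (OmegaOne → ℝ))} (hL : ∀ j, IsClosed (L j))
    (hα : ∀ j, DependsBelow α (L j))
    (hfin : ∀ t : Finset J, (points d F S ∩ ⋂ j ∈ t, L j).Nonempty) :
    (points d F S ∩ ⋂ j, L j).Nonempty := by
  obtain ⟨_, ⟨c, rfl⟩, hc⟩ := (isCompact_range (continuous_embed d F)).inter_iInter_nonempty L hL
    fun t => (hfin t).mono (Set.inter_subset_inter_left _ (by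
      rintro _ ⟨p, rfl⟩
      exact ⟨S p, rfl⟩))
  obtain ⟨p, -, hp⟩ := hS.exists_mem (W := ⋂ j, L j) (d := d) (F := F) (c := c) (α := α)
    (fun z z' h₁ h₂ hz => Set.mem_iInter.2 fun j => hα j z z' h₁ h₂ (Set.mem_iInter.1 hz j)) hc
  exact ⟨_, ⟨p, rfl⟩, hp⟩

theorem exists_mem_of_dense {D : Set P} (hD : Dense (S '' D))
    {O : Set (unitInterval × (OmegaOne → ℝ))} (hO : IsOpen O)
    {c : unitInterval × (OmegaOne → Bool)} (hc : embed d F c ∈ O) :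
    ∃ p ∈ D, embed d F (S p) ∈ O := by
  obtain ⟨_, hp, p, hpD, rfl⟩ :=
    hD.inter_open_nonempty _ (hO.preimage (continuous_embed d F)) ⟨c, hc⟩
  exact ⟨p, hpD, hp⟩

/-- A separation of the subspace is traced by countably many basic sets around dense points, so by
sets depending on coordinates below some `α`. Their closures cover the connected compact space and
so meet; `embed_mem_closure` moves a common point into the subspace, where density contradicts
disjointness. -/
theorem IsFull.isPreconnected_points (hS : IsFull S) {D : Set P} (hDc : D.Countable)
    (hD : Dense (S '' D)) : IsPreconnected (points d F S) := by
  intro U V hU hV hUV ⟨_, ⟨pU, rfl⟩, hpU⟩ ⟨_, ⟨pV, rfl⟩, hpV⟩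
  have := hDc.to_subtype
  have hsub : points d F S ⊆ Set.range (embed d F) := by
    rintro _ ⟨p, rfl⟩
    exact ⟨S p, rfl⟩
  by_contra hne
  have hdisj : ∀ p, embed d F (S p) ∈ U → embed d F (S p) ∉ V :=
    fun p hU hV => hne ⟨_, ⟨p, rfl⟩, hU, hV⟩
  have hball : ∀ p : D, ∃ (G : Finset OmegaOne) (ε : ℝ), 0 < ε ∧
      ({z | radial G (embed d F (S p)) z < ε} ⊆ U ∨ {z | radial G (embed d F (S p)) z < ε} ⊆ V) := by
    intro p
    rcases hUV ⟨p, rfl⟩ with h | h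
    · obtain ⟨G, ε, hε, hG⟩ := exists_radial_lt_subset (hU.mem_nhds h)
      exact ⟨G, ε, hε, Or.inl hG⟩
    · obtain ⟨G, ε, hε, hG⟩ := exists_radial_lt_subset (hV.mem_nhds h)
      exact ⟨G, ε, hε, Or.inr hG⟩
  choose G ε hε hG using hball
  obtain ⟨α, hα⟩ := exists_forall_finset_lt G
  let W : Set (unitInterval × (OmegaOne → ℝ)) → Set (unitInterval × (OmegaOne → ℝ)) := fun O =>
    ⋃ p : D, ⋃ _ : {z | radial (G p) (embed d F (S p)) z < ε p} ⊆ O,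
      {z | radial (G p) (embed d F (S p)) z < ε p}
  have hWsub : ∀ O, W O ⊆ O := fun O => Set.iUnion₂_subset fun p hp => hp
  have hWopen : ∀ O, IsOpen (W O) := fun O => isOpen_iUnion fun p => isOpen_iUnion fun _ =>
    isOpen_lt (continuous_radial _ _) continuous_const
  have hWdep : ∀ O, DependsBelow α (W O) := by
    intro O z z' h₁ h₂ hz
    obtain ⟨p, hp, hz⟩ := Set.mem_iUnion₂.1 hz
    exact Set.mem_iUnion₂.2 ⟨p, hp, dependsBelow_radial (hα p) _ (Set.Iio (ε p)) z z' h₁ h₂ hz⟩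
  have hWmem : ∀ p ∈ D, embed d F (S p) ∈ W U ∪ W V := by
    intro p hp
    rcases hG ⟨p, hp⟩ with h | h
    · exact Or.inl (Set.mem_iUnion₂.2 ⟨⟨p, hp⟩, h, by simpa using hε ⟨p, hp⟩⟩)
    · exact Or.inr (Set.mem_iUnion₂.2 ⟨⟨p, hp⟩, h, by simpa using hε ⟨p, hp⟩⟩)
  obtain ⟨_, ⟨c, rfl⟩, hcU, hcV⟩ :=
    isPreconnected_closed_iff.1 (isPreconnected_range_embed d F)
      (closure (W U ∩ Set.range (embed d F))) (closure (W V ∩ Set.range (embed d F)))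
      isClosed_closure isClosed_closure
      (by
        rintro _ ⟨c, rfl⟩
        rw [← closure_union, ← Set.union_inter_distrib_right, mem_closure_iff]
        intro o ho hc
        obtain ⟨p, hp, hpo⟩ := exists_mem_of_dense hD ho hc
        exact ⟨_, hpo, hWmem p hp, _, rfl⟩)
      (by
        obtain ⟨p, hp, hpU⟩ := exists_mem_of_dense hD hU hpU
        refine ⟨_, ⟨S p, rfl⟩, subset_closure ⟨(hWmem p hp).resolve_right fun h => ?_, _, rfl⟩⟩
        exact hdisj p hpU (hWsub V h))
      (by
        obtain ⟨p, hp, hpV⟩ := exists_mem_of_dense hD hV hpV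
        refine ⟨_, ⟨S p, rfl⟩, subset_closure ⟨(hWmem p hp).resolve_left fun h => ?_, _, rfl⟩⟩
        exact hdisj p (hWsub U h) hpV)
  obtain ⟨q, hq₁, hq₂⟩ := hS.exists_eq (d := d) (F := F) α c
  have hqU := embed_mem_closure (hWdep U) hq₁ hq₂ hcU
  have hqV := embed_mem_closure (hWdep V) hq₁ hq₂ hcV
  have key : ∀ O O', IsOpen O → embed d F (S q) ∈ O →
      embed d F (S q) ∈ closure (W O' ∩ Set.range (embed d F)) → ∃ p, embed d F (S p) ∈ O ∩ O' := by
    intro O O' hO hqO hqO'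
    obtain ⟨_, hcO, hcO', c, rfl⟩ := mem_closure_iff.1 hqO' O hO hqO
    obtain ⟨p, -, hpO, hpO'⟩ := exists_mem_of_dense hD (hO.inter (hWopen O')) ⟨hcO, hcO'⟩
    exact ⟨p, hpO, hWsub _ hpO'⟩
  rcases hUV ⟨q, rfl⟩ with h | h
  · obtain ⟨p, hp, hp'⟩ := key U V hU h hqV
    exact hdisj p hp hp'
  · obtain ⟨p, hp, hp'⟩ := key V U hV h hqU
    exact hdisj p hp' hp

/-- The radii of a family of balls can be chosen such that no ball touches the boundary of an earlier
one from inside, and no radius occurs twice. -/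
theorem exists_radii {Y : Type*} (v : OmegaOne → Y → ℝ) {δ : OmegaOne → ℝ} (hδ : ∀ ξ, 0 < δ ξ) :
    ∃ r : OmegaOne → ℝ, ∀ ξ, (0 < r ξ ∧ r ξ < δ ξ) ∧ ∀ η < ξ, r ξ ≠ r η ∧
      ({y | v ξ y < r ξ} ⊆ {y | v η y < r η} → {y | v ξ y ≤ r ξ} ⊆ {y | v η y < r η}) := by
  refine exists_forall_lt_of_forall_exists (p := fun ξ r => 0 < r ∧ r < δ ξ)
    (R := fun ξ r η s => r ≠ s ∧
      ({y | v ξ y < r} ⊆ {y | v η y < s} → {y | v ξ y ≤ r} ⊆ {y | v η y < s})) fun ξ f => ?_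
  let bad : OmegaOne → Set ℝ := fun η => {r | r = f η} ∪
    {r | {y | v ξ y < r} ⊆ {y | v η y < f η} ∧ ¬ {y | v ξ y ≤ r} ⊆ {y | v η y < f η}}
  have hbad : (⋃ η ∈ Set.Iio ξ, bad η).Countable := by
    refine (OmegaOne.countable_Iio ξ).biUnion fun η _ => (Set.countable_singleton (f η)).union
      (Set.Subsingleton.countable ?_)
    -- Of two radii with open ball inside, the smaller has its closed ball inside. So each earlier
    -- `η` forbids at most one radius besides `f η`.
    have hlt : ∀ r r' : ℝ, r < r' → {y | v ξ y < r'} ⊆ {y | v η y < f η} →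
        {y | v ξ y ≤ r} ⊆ {y | v η y < f η} :=
      fun r r' hr h y hy => h (lt_of_le_of_lt (show v ξ y ≤ r from hy) hr)
    rintro r ⟨h₁, h₂⟩ r' ⟨h₁', h₂'⟩
    rcases lt_trichotomy r r' with h | h | h
    · exact absurd (hlt r r' h h₁') h₂
    · exact h
    · exact absurd (hlt r' r h h₁) h₂'
  obtain ⟨r, hr, hrbad⟩ : (Set.Ioo 0 (δ ξ) \ ⋃ η ∈ Set.Iio ξ, bad η).Nonempty := by
    rw [Set.sdiff_nonempty]
    exact fun h => (Cardinal.Real.Ioo_countable_iff.1 (hbad.mono h)).not_gt (hδ ξ)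
  refine ⟨r, hr, fun η hη => ?_⟩
  have : r ∉ bad η := fun h => hrbad (Set.mem_biUnion hη h)
  simp only [bad, Set.mem_union, Set.mem_ofPred_eq, not_or, not_and, not_not] at this
  exact this

end Full

/-! ### The family of codes -/

/-- Indices of the points of a countable dense set: an approximate position in the interval, the
description of a finite family of finite sets of natural numbers, and a counter. -/
abbrev DenseIndex : Type := ℕ × (ℕ × Finset (Finset ℕ)) × ℕ

/-- Indices of all points: the dense set, and all countable initial parts of codes. -/
abbrev PointIndex : Type := DenseIndex ⊕ Σ β : OmegaOne, unitInterval × (Set.Iio β → Bool)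

/-- A pair of points to be separated, and a basic neighbourhood of a point of the dense set outside
of which they are to be separated. -/
abbrev SeparationTask : Type := PointIndex × PointIndex × DenseIndex × Finset OmegaOne

theorem mk_pointIndex (hCH : (𝔠 : Cardinal.{0}) = ℵ₁) : #PointIndex = ℵ₁ := by
  have h_fiber : ∀ β : OmegaOne, #(unitInterval × (Set.Iio β → Bool)) ≤ ℵ₁ := by
    intro β
    have h₁ : #unitInterval ≤ 𝔠 := (Cardinal.mk_set_le _).trans Cardinal.mk_real.le
    have h₂ : #(Set.Iio β → Bool) ≤ 𝔠 := by
      rw [← Cardinal.two_power_aleph0]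
      simpa using Cardinal.power_le_power_left (a := 2) two_ne_zero
        (Cardinal.le_aleph0_iff_set_countable.2 (OmegaOne.countable_Iio β))
    rw [← hCH, ← Cardinal.continuum_mul_self]
    simpa using mul_le_mul' h₁ h₂
  have h_sigma : #(Σ β : OmegaOne, unitInterval × (Set.Iio β → Bool)) ≤ ℵ₁ := by
    rw [Cardinal.mk_sigma]
    refine (Cardinal.sum_le_sum _ _ h_fiber).trans ?_
    rw [Cardinal.sum_const']
    rw [mk_omegaOne, Cardinal.mul_eq_self (Cardinal.aleph0_le_aleph 1)]
  refine le_antisymm ?_ ?_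
  · rw [Cardinal.mk_sum, Cardinal.lift_id, Cardinal.lift_id]
    exact Cardinal.add_le_of_le (Cardinal.aleph0_le_aleph 1)
      (Cardinal.mk_le_aleph0.trans (Cardinal.aleph0_le_aleph 1)) h_sigma
  · rw [← mk_omegaOne]
    exact Cardinal.mk_le_of_injective (f := fun β => Sum.inr ⟨β, 0, fun _ => false⟩)
      fun β γ h => congrArg Sigma.fst (Sum.inr_injective h)

/-- Under CH there are ℵ₁ tasks. Enumerating tasks paired with countable ordinals makes each task
occur uncountably often, hence cofinally. -/
theorem exists_bookkeeping (hCH : (𝔠 : Cardinal.{0}) = ℵ₁) :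
    ∃ g : OmegaOne → SeparationTask, ∀ t β, ∃ α, β < α ∧ g α = t := by
  have hcard : #(SeparationTask × OmegaOne) ≤ #OmegaOne := by
    have h : ℵ₀ ≤ ℵ₁ := Cardinal.aleph0_le_aleph 1
    have h_dense : #DenseIndex ≤ ℵ₁ := Cardinal.mk_le_aleph0.trans h
    simp only [SeparationTask, Cardinal.mk_prod, Cardinal.lift_id, Cardinal.mk_finset_of_infinite,
      mk_omegaOne, mk_pointIndex hCH] at h_dense ⊢
    exact Cardinal.mul_le_of_le h (Cardinal.mul_le_of_le h le_rfl (Cardinal.mul_le_of_le h le_rfl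
      (Cardinal.mul_le_of_le h h_dense le_rfl))) le_rfl
  have : Nonempty (SeparationTask × OmegaOne) := 
    ⟨(Sum.inl default, Sum.inl default, default, ∅), Classical.arbitrary _⟩
  obtain ⟨f⟩ := hcard
  have hf := Function.invFun_surjective f.injective
  refine ⟨fun α => (Function.invFun f α).1, fun t β => ?_⟩
  by_contra! h
  refine Set.not_countable_univ (α := OmegaOne)
    (((OmegaOne.countable_Iic β).image fun α => (Function.invFun f α).2).mono fun γ _ => ?_)
  obtain ⟨α, hα⟩ := hf (t, γ)
  refine ⟨α, ?_, by simp [hα]⟩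
  by_contra hαβ
  exact h α (not_le.1 hαβ) (by simp [hα])

/-! ### Signs of the points: fullness, separation, density -/

namespace PointIndex

/-- The position in the unit interval. -/
noncomputable def position : PointIndex → unitInterval
  | Sum.inl n => TopologicalSpace.denseSeq unitInterval n.1
  | Sum.inr a => a.2.1

open Classical in
/-- The signs before bookkeeping, for an injective family `e` of sets of natural numbers. -/
noncomputable def baseSign (e : OmegaOne → Set ℕ) : PointIndex → OmegaOne → Bool
  | Sum.inl n, α => decide ((Finset.range n.2.1.1).filter (· ∈ e α) ∈ n.2.1.2)
  | Sum.inr a, α => if h : α < a.1 then a.2.2 ⟨α, h⟩ else false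

/-- The sign at stage `α` is not prescribed. -/
def IsFreeAt (α : OmegaOne) : PointIndex → Prop
  | Sum.inl _ => True
  | Sum.inr a => a.1 ≤ α

open Classical in
/-- The signs after bookkeeping. -/
noncomputable def sign (e : OmegaOne → Set ℕ) (g : OmegaOne → SeparationTask) (p : PointIndex)
    (α : OmegaOne) : Bool :=
  if IsFreeAt α p ∧ (g α).1 = p then true
  else if IsFreeAt α p ∧ (g α).2.1 = p then false
  else baseSign e p α

/-- The code of a point. -/
noncomputable def code (e : OmegaOne → Set ℕ) (g : OmegaOne → SeparationTask) (p : PointIndex) :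
    unitInterval × (OmegaOne → Bool) :=
  (position p, sign e g p)

theorem exists_forall_isFreeAt (p : PointIndex) : ∃ β, ∀ α, β < α → IsFreeAt α p := by
  rcases p with n | a
  · exact ⟨Classical.arbitrary _, fun _ _ => trivial⟩
  · exact ⟨a.1, fun α hα => hα.le⟩

theorem isFull_code (e : OmegaOne → Set ℕ) (g : OmegaOne → SeparationTask) : IsFull (code e g) := by
  intro α c
  -- Bookkeeping never overrides the signs of this point before `α`.
  refine ⟨Sum.inr ⟨α, c.1, fun i => c.2 i⟩, rfl, fun i hi => ?_⟩
  simp [code, sign, IsFreeAt, baseSign, hi, hi.not_ge]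

theorem exists_separating (e : OmegaOne → Set ℕ) {g : OmegaOne → SeparationTask}
    (hg : ∀ t β, ∃ α, β < α ∧ g α = t) {p q : PointIndex} (hpq : p ≠ q) (n : DenseIndex)
    (G : Finset OmegaOne) :
    ∃ α, (g α).2.2 = (n, G) ∧ (∀ i ∈ G, i < α) ∧
      sign e g p α = true ∧ sign e g q α = false := by
  obtain ⟨β, hβ⟩ := exists_forall_isFreeAt p
  obtain ⟨γ, hγ⟩ := exists_forall_isFreeAt q
  obtain ⟨δ, hδ⟩ := OmegaOne.exists_forall_lt G.countable_toSet
  obtain ⟨α, hα, hgα⟩ := hg (p, q, n, G) (max (max β γ) δ)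
  simp only [max_lt_iff] at hα
  refine ⟨α, by rw [hgα], fun i hi => (hδ i hi).trans hα.2, ?_, ?_⟩
  · simp [sign, hβ α hα.1.1, hgα]
  · simp [sign, hγ α hα.1.2, hgα, hpq]

/-- As in the Hewitt–Marczewski–Pondiczery theorem: finitely many distinct sets of naturals have
distinct traces on some initial segment, and a finite family of traces prescribes the signs. -/
theorem exists_baseSign_eq {e : OmegaOne → Set ℕ} (he : Function.Injective e)
    (G : Finset OmegaOne) (b : OmegaOne → Bool) :
    ∃ x : ℕ × Finset (Finset ℕ), ∀ m j, ∀ α ∈ G, baseSign e (Sum.inl (m, x, j)) α = b α := by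
  classical
  obtain ⟨k, hk⟩ : ∃ k, ∀ α ∈ G, ∀ β ∈ G,
      (Finset.range k).filter (· ∈ e α) = (Finset.range k).filter (· ∈ e β) → α = β := by
    have : ∀ α β, ∃ k, α ≠ β → ∃ i < k, ¬ (i ∈ e α ↔ i ∈ e β) := by
      intro α β
      by_cases h : α = β
      · exact ⟨0, fun h' => absurd h h'⟩
      · obtain ⟨i, hi⟩ := not_forall.1 (mt Set.ext (he.ne h))
        exact ⟨i + 1, fun _ => ⟨i, i.lt_succ_self, hi⟩⟩
    choose k hk using this
    refine ⟨(G ×ˢ G).sup fun x => k x.1 x.2, fun α hα β hβ h => ?_⟩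
    by_contra hne
    obtain ⟨i, hi, hne⟩ := hk α β hne
    have hi : i < (G ×ˢ G).sup fun x => k x.1 x.2 :=
      hi.trans_le (Finset.le_sup (f := fun x => k x.1 x.2) (Finset.mk_mem_product hα hβ))
    have := Finset.ext_iff.1 h i
    simp only [Finset.mem_filter, Finset.mem_range, hi, true_and] at this
    exact hne this
  refine ⟨(k, (G.filter (b · = true)).image fun α => (Finset.range k).filter (· ∈ e α)),
    fun m j α hα => ?_⟩
  rw [Bool.eq_iff_iff]
  simp only [baseSign, decide_eq_true_eq, Finset.mem_image, Finset.mem_filter]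
  constructor
  · rintro ⟨β, ⟨hβ, hb⟩, h⟩
    rwa [← hk β hβ α hα h]
  · exact fun hb => ⟨α, ⟨hα, hb⟩, rfl⟩

theorem dense_code {e : OmegaOne → Set ℕ} (he : Function.Injective e) (g : OmegaOne → SeparationTask) :
    Dense (code e g '' Set.range Sum.inl) := by
  classical
  rw [dense_iff_inter_open]
  rintro O hO ⟨c, hc⟩
  obtain ⟨u, v, hu, hv, hcu, hcv, huv⟩ := isOpen_prod_iff.1 hO c.1 c.2 hc
  obtain ⟨G, t, ht, htv⟩ := isOpen_pi_iff.1 hv c.2 hcv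
  obtain ⟨m, hm⟩ := (TopologicalSpace.denseRange_denseSeq unitInterval).exists_mem_open hu ⟨_, hcu⟩
  obtain ⟨x, hx⟩ := exists_baseSign_eq he G c.2
  let used : Finset PointIndex := G.image (fun α => (g α).1) ∪ G.image fun α => (g α).2.1
  -- The counter supplies infinitely many copies of the point, and bookkeeping at the finitely many
  -- stages in `G` alters only finitely many.
  obtain ⟨j, hj⟩ : ∃ j : ℕ, (Sum.inl (m, x, j) : PointIndex) ∉ used :=
    (used.finite_toSet.preimage (f := fun j : ℕ => (Sum.inl (m, x, j) : PointIndex))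
      fun i _ j _ h => by simpa using h).infinite_compl.nonempty
  refine ⟨_, huv (Set.mk_mem_prod hm (htv fun α hα => ?_)), _, ⟨(m, x, j), rfl⟩, rfl⟩
  have h₁ : (g α).1 ≠ Sum.inl (m, x, j) := fun h =>
    hj (Finset.mem_union_left _ (Finset.mem_image.2 ⟨α, hα, h⟩))
  have h₂ : (g α).2.1 ≠ Sum.inl (m, x, j) := fun h =>
    hj (Finset.mem_union_right _ (Finset.mem_image.2 ⟨α, hα, h⟩))
  simp only [sign, h₁, h₂, and_false, if_false, hx m j α hα]
  exact (ht α hα).2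

end PointIndex

/-! ### The strong Choquet game -/

theorem TopologicalSpace.IsTopologicalBasis.stronglyChoquet {X : Type*} [TopologicalSpace X]
    {B : Set (Set X)} (hB : IsTopologicalBasis B)
    (h : ∀ b : ℕ → Set X, (∀ n, b n ∈ B) → Antitone b → (⋂ n, b n).Nonempty) :
    StronglyChoquet X := by
  have hex : ∀ m : X × Set X, ∃ V, IsOpen m.2 → m.1 ∈ m.2 → V ∈ B ∧ m.1 ∈ V ∧ V ⊆ m.2 := by
    intro m
    by_cases hm : IsOpen m.2 ∧ m.1 ∈ m.2
    · obtain ⟨V, hV, hmV, hVm⟩ := hB.exists_subset_of_mem_open hm.2 hm.1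
      exact ⟨V, fun _ _ => ⟨hV, hmV, hVm⟩⟩
    · exact ⟨∅, fun h₁ h₂ => absurd ⟨h₁, h₂⟩ hm⟩
  choose V hV using hex
  -- Player II looks only at the last move and answers with a basis element; the value `∅` on the
  -- empty list never occurs in a run.
  refine ⟨fun l => l.getLast?.elim ∅ V, fun p => ?_⟩
  have hans : ∀ n, StrongChoquetGame.answer (fun l => l.getLast?.elim ∅ V) p n = V (p n) := by
    intro n
    simp [StrongChoquetGame.answer, List.range_succ]
  refine ⟨fun n hn => ?_, fun hp => ?_⟩
  · obtain ⟨h₁, h₂, -⟩ := hn n le_rfl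
    obtain ⟨hB', hmem, hsub⟩ := hV _ h₁ h₂
    simp only [StrongChoquetGame.LegalAnswer, hans]
    exact ⟨hB.isOpen hB', hmem, hsub⟩
  · have hV' := fun n => hV _ (hp n).1 (hp n).2.1
    obtain ⟨x, hx⟩ := h (fun n => V (p n)) (fun n => (hV' n).1) (antitone_nat_of_succ_le fun n => by
      have := (hp (n + 1)).2.2 n rfl
      rw [hans] at this
      exact (hV' (n + 1)).2.2.trans this)
    exact ⟨x, Set.mem_iInter.2 fun n => (hV' n).2.2 (Set.mem_iInter.1 hx n)⟩

/-! ### Topological properties of the space of points -/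

section Points

variable {P : Type} {d : OmegaOne → unitInterval × (OmegaOne → Bool)}
  {F : OmegaOne → Finset OmegaOne} {S : P → unitInterval × (OmegaOne → Bool)} {D : Set P}

theorem separableSpace_points (hDc : D.Countable) (hD : Dense (S '' D)) :
    TopologicalSpace.SeparableSpace (points d F S) := by
  refine ⟨(fun p => ⟨embed d F (S p), p, rfl⟩) '' D, hDc.image _, ?_⟩
  rw [dense_iff_inter_open]
  rintro _ ⟨O, hO, rfl⟩ ⟨⟨_, q, rfl⟩, hq⟩
  obtain ⟨p, hp, hpO⟩ := exists_mem_of_dense hD hO hq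
  exact ⟨⟨embed d F (S p), p, rfl⟩, hpO, p, hp, rfl⟩

theorem IsFull.connectedSpace_points (hS : IsFull S) (hDc : D.Countable) (hD : Dense (S '' D)) :
    ConnectedSpace (points d F S) := by
  obtain ⟨p, -⟩ := hS (Classical.arbitrary _) (0, fun _ => false)
  exact isConnected_iff_connectedSpace.1
    ⟨⟨_, p, rfl⟩, hS.isPreconnected_points hDc hD⟩

/-- Some stage doubles around a dense point whose basic neighbourhood lies in `O`, with opposite
signs for the two given points. Its coordinate has no zero off `O`. -/
theorem totallySeparatedSpace_compl (hD : Dense (S '' D))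
    (hsep : ∀ p q, p ≠ q → ∀ n ∈ D, ∀ G : Finset OmegaOne, ∃ α, d α = S n ∧ F α = G ∧
      (∀ i ∈ G, i < α) ∧ (S p).2 α = true ∧ (S q).2 α = false)
    {O : Set (points d F S)} (hO : IsOpen O) (hne : O.Nonempty) : TotallySeparatedSpace ↥(Oᶜ) := by
  obtain ⟨O, hO, rfl⟩ := hO
  obtain ⟨⟨_, p, rfl⟩, hp⟩ := hne
  obtain ⟨n, hn, hnO⟩ := exists_mem_of_dense hD hO hp
  obtain ⟨G, ε, hε, hG⟩ := exists_radial_lt_subset (hO.mem_nhds hnO)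
  rw [totallySeparatedSpace_iff_exists_isClopen]
  rintro ⟨⟨_, p, rfl⟩, hp⟩ ⟨⟨_, q, rfl⟩, hq⟩ hpq
  obtain ⟨α, hdα, hFα, hlt, hpα, hqα⟩ := hsep p q (by rintro rfl; exact hpq rfl) n hn G
  have hgap : ∀ c, embed d F c ∉ O → 0 < gap d F α c := by
    intro c hc
    refine (gap_nonneg d F α c).lt_of_ne' fun h => hc (hG ?_)
    rw [gap, hdα, hFα, Finset.filter_true_of_mem hlt] at h
    exact h.trans_lt hε
  let φ : ↥(Subtype.val ⁻¹' O : Set (points d F S))ᶜ → ℝ := fun z => z.1.1.2 α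
  have hφ : Continuous φ :=
    (continuous_apply α).comp (continuous_snd.comp (continuous_subtype_val.comp
      continuous_subtype_val))
  have hφ_ne : ∀ z, φ z ≠ 0 := by
    rintro ⟨⟨_, p, rfl⟩, hp⟩
    have := (hgap _ hp).ne'
    change coord d F α (S p) ≠ 0
    rw [coord_eq]
    split_ifs <;> simpa
  refine ⟨φ ⁻¹' Set.Ioi 0, ⟨?_, isOpen_Ioi.preimage hφ⟩, ?_, ?_⟩
  · have : φ ⁻¹' Set.Ioi 0 = φ ⁻¹' Set.Ici 0 := by
      ext z
      simp only [Set.mem_preimage, Set.mem_Ioi, Set.mem_Ici]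
      exact ⟨le_of_lt, fun h => lt_of_le_of_ne h (hφ_ne z).symm⟩
    rw [this]
    exact isClosed_Ici.preimage hφ
  · change 0 < coord d F α (S p)
    rw [coord_eq, hpα]
    simpa using hgap _ hp
  · change ¬ 0 < coord d F α (S q)
    rw [coord_eq, hqα]
    simpa using (hgap _ hq).le

theorem IsFull.exists_fst_eq (hS : IsFull S) (t : unitInterval) : ∃ x : points d F S, x.1.1 = t := by
  obtain ⟨p, hp, -⟩ := hS (Classical.arbitrary _) (t, fun _ => false)
  exact ⟨⟨_, p, rfl⟩, hp⟩

/-- By connectedness the radial function at a point of `O` takes all small nonnegative values, and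
it takes them inside `O`. -/
theorem IsFull.not_countable_of_isOpen (hS : IsFull S) [PreconnectedSpace (points d F S)]
    {O : Set (points d F S)} (hO : IsOpen O) (hne : O.Nonempty) : ¬ O.Countable := by
  intro hc
  obtain ⟨O, hO, rfl⟩ := hO
  obtain ⟨x, hx⟩ := hne
  obtain ⟨G, ε, hε, hG⟩ := exists_radial_lt_subset (hO.mem_nhds hx)
  let φ : points d F S → ℝ := fun z => radial G x.1 z.1
  have hφ : Continuous φ := (continuous_radial _ _).comp continuous_subtype_val
  -- One endpoint of the interval is at distance at least 1/2 from any position.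
  obtain ⟨y, hy⟩ : ∃ y, 1 / 2 ≤ φ y := by
    have : ∃ t : unitInterval, 1 / 2 ≤ dist t x.1.1 := by
      rcases le_total (x.1.1 : ℝ) (1 / 2) with h | h
      · exact ⟨1, (le_trans (by simp; linarith) (le_abs_self _) : _ ≤ |(1 : ℝ) - x.1.1|)⟩
      · exact ⟨0, (le_trans (by simp; linarith) (neg_le_abs _) : _ ≤ |(0 : ℝ) - x.1.1|)⟩
    obtain ⟨t, ht⟩ := this
    obtain ⟨y, rfl⟩ := hS.exists_fst_eq (d := d) (F := F) t
    exact ⟨y, ht.trans (le_add_of_nonneg_right (Finset.sum_nonneg fun _ _ => dist_nonneg))⟩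
  have hφx : φ x = 0 := radial_self _ _
  have hsub : Set.Ico 0 (min ε (1 / 2)) ⊆ φ '' (Subtype.val ⁻¹' O) := by
    rintro s ⟨hs₀, hs⟩
    obtain ⟨z, rfl⟩ := intermediate_value_univ x y hφ
      ⟨hφx.trans_le hs₀, (hs.le.trans (min_le_right _ _)).trans hy⟩
    exact ⟨z, hG (hs.trans_le (min_le_left _ _)), rfl⟩
  have := Cardinal.Real.Ico_countable_iff.1 ((hc.image φ).mono hsub)
  exact this.not_gt (lt_min hε (by norm_num))

theorem IsFull.mk_points (hS : IsFull S) (hP : #P = ℵ₁) : #(points d F S) = ℵ₁ := by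
  refine le_antisymm (hP ▸ Cardinal.mk_range_le) (Cardinal.aleph_one_le_continuum.trans ?_)
  rw [← Cardinal.mk_Icc_real (zero_lt_one (α := ℝ))]
  exact Cardinal.mk_le_of_surjective (f := fun x : points d F S => x.1.1)
    fun t => hS.exists_fst_eq t

/-! ### The basis -/

variable {center : OmegaOne → P} {G : OmegaOne → Finset OmegaOne} {r : OmegaOne → ℝ}

variable (d F S center G r) in
/-- The ball in the space of points with the given centre, coordinates and radius. -/
def ball (ξ : OmegaOne) : Set (points d F S) :=
  {x | radial (G ξ) (embed d F (S (center ξ))) x.1 < r ξ}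

theorem mem_ball_iff {ξ : OmegaOne} {x : points d F S} : x ∈ ball d F S center G r ξ ↔
    radial (G ξ) (embed d F (S (center ξ))) x.1 < r ξ :=
  Iff.rfl

theorem center_mem_ball (hr : ∀ ξ, 0 < r ξ) (ξ : OmegaOne) :
    (⟨embed d F (S (center ξ)), center ξ, rfl⟩ : points d F S) ∈ ball d F S center G r ξ :=
  (radial_self _ _).trans_lt (hr ξ)

theorem isTopologicalBasis_range_ball (hr : ∀ ξ, 0 < r ξ)
    (hex : ∀ p H, ∀ ε > 0, ∃ ξ, center ξ = p ∧ G ξ = H ∧ r ξ < ε) :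
    TopologicalSpace.IsTopologicalBasis (Set.range (ball d F S center G r)) := by
  refine TopologicalSpace.isTopologicalBasis_of_isOpen_of_nhds ?_ ?_
  · rintro _ ⟨ξ, rfl⟩
    exact isOpen_lt ((continuous_radial _ _).comp continuous_subtype_val) continuous_const
  · rintro ⟨_, p, rfl⟩ _ hp ⟨O, hO, rfl⟩
    obtain ⟨H, ε, hε, hH⟩ := exists_radial_lt_subset (hO.mem_nhds hp)
    obtain ⟨ξ, rfl, rfl, hξ⟩ := hex p H ε hε
    exact ⟨_, ⟨ξ, rfl⟩, center_mem_ball hr ξ, fun x hx => hH (lt_trans hx hξ)⟩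

/-- The complements of the balls are closed and jointly depend on countably many coordinates, so
compactness passes to the subspace. -/
theorem IsFull.exists_finite_subcover (hS : IsFull S) {C : Set (Set (points d F S))}
    (hCB : C ⊆ Set.range (ball d F S center G r)) (hC : C.Countable) (hcov : ⋃₀ C = Set.univ) :
    ∃ T ⊆ C, T.Finite ∧ ⋃₀ T = Set.univ := by
  classical
  by_contra! hT
  have := hC.to_subtype
  choose ξ hξ using fun c : C => hCB c.2
  obtain ⟨α, hα⟩ := exists_forall_finset_lt fun c => G (ξ c)
  obtain ⟨x, hx, hxL⟩ := hS.inter_iInter_nonempty (d := d) (F := F) (α := α)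
    (L := fun c => radial (G (ξ c)) (embed d F (S (center (ξ c)))) ⁻¹' Set.Ici (r (ξ c)))
    (fun c => isClosed_Ici.preimage (continuous_radial _ _))
    (fun c => dependsBelow_radial (hα c) _ _) (fun t => by
      obtain ⟨x, hx⟩ := (Set.ne_univ_iff_exists_notMem _).1
        (hT (t.image Subtype.val : Finset _) (by simp) (Finset.finite_toSet _))
      refine ⟨x.1, x.2, Set.mem_iInter₂.2 fun c hc => ?_⟩
      rw [Set.mem_preimage, Set.mem_Ici, ← not_lt, ← mem_ball_iff (x := ⟨x.1, x.2⟩), hξ]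
      exact fun hlt => hx ⟨c.1, by simpa using hc, hlt⟩)
  obtain ⟨c, hc, hxc⟩ := hcov.symm ▸ Set.mem_univ (⟨x, hx⟩ : points d F S)
  rw [show c = ball d F S center G r (ξ ⟨c, hc⟩) from (hξ ⟨c, hc⟩).symm, mem_ball_iff] at hxc
  have := Set.mem_iInter.1 hxL ⟨c, hc⟩
  rw [Set.mem_preimage, Set.mem_Ici] at this
  exact this.not_gt hxc

theorem IsFull.iInter_nonempty_of_antitone (hS : IsFull S) (hr : ∀ ξ, 0 < r ξ)
    (hle : ∀ ξ, ∀ η < ξ, ball d F S center G r ξ ⊆ ball d F S center G r η →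
      {x : points d F S | radial (G ξ) (embed d F (S (center ξ))) x.1 ≤ r ξ} ⊆
        ball d F S center G r η)
    {b : ℕ → Set (points d F S)} (hb : ∀ n, b n ∈ Set.range (ball d F S center G r))
    (hanti : Antitone b) : (⋂ n, b n).Nonempty := by
  choose ξ hξ using hb
  obtain ⟨g, hg⟩ := exists_increasing_or_nonincreasing_subseq (· < ·) ξ
  suffices h : (⋂ n, b (g n)).Nonempty by
    obtain ⟨x, hx⟩ := h
    exact ⟨x, Set.mem_iInter.2 fun n =>
      hanti (g.strictMono.le_apply (x := n)) (Set.mem_iInter.1 hx n)⟩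
  have hsub : ∀ {m n}, m ≤ n → ball d F S center G r (ξ (g n)) ⊆ ball d F S center G r (ξ (g m)) := by
    intro m n hmn
    rw [hξ, hξ]
    exact hanti (g.monotone hmn)
  rcases hg with hg | hg
  · obtain ⟨α, hα⟩ := exists_forall_finset_lt fun n => G (ξ (g n))
    obtain ⟨x, hx, hxL⟩ := hS.inter_iInter_nonempty (d := d) (F := F) (α := α)
      (L := fun n => radial (G (ξ (g n))) (embed d F (S (center (ξ (g n))))) ⁻¹' Set.Iic (r (ξ (g n))))
      (fun n => isClosed_Iic.preimage (continuous_radial _ _))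
      (fun n => dependsBelow_radial (hα n) _ _) (fun t => by
        refine ⟨_, ⟨center (ξ (g (t.sup id))), rfl⟩, Set.mem_iInter₂.2 fun n hn => ?_⟩
        have hlt := hsub (Finset.le_sup (f := id) hn) (center_mem_ball hr (ξ (g (t.sup id))))
        exact (mem_ball_iff.1 hlt).le)
    refine ⟨⟨x, hx⟩, Set.mem_iInter.2 fun n => ?_⟩
    rw [← hξ]
    -- The common point lies in closed balls only; closed ball `n + 1` is inside open ball `n`.
    exact hle _ _ (hg n (n + 1) n.lt_succ_self) (hsub n.le_succ) (Set.mem_iInter.1 hxL (n + 1))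
  · obtain ⟨m, hm⟩ : ∃ m, ∀ n, ξ (g m) ≤ ξ (g n) := by
      obtain ⟨_, ⟨m, rfl⟩, hm⟩ := wellFounded_lt.has_min (Set.range fun n => ξ (g n)) ⟨_, 0, rfl⟩
      exact ⟨m, fun n => not_lt.1 (hm _ ⟨n, rfl⟩)⟩
    refine ⟨⟨_, center (ξ (g m)), rfl⟩, Set.mem_iInter.2 fun n => ?_⟩
    have hmax : ξ (g (max m n)) = ξ (g m) := by
      rcases (le_max_left m n).eq_or_lt with h | h
      · rw [← h]
      · exact le_antisymm (not_lt.1 (hg _ _ h)) (hm _)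
    rw [← hξ]
    refine hsub (le_max_right m n) ?_
    rw [hmax]
    exact center_mem_ball hr _

/-- These balls measure only the distance of the position from 0, and a point at position `r ξ`
tells radius `r ξ` from any larger one. This gives ℵ₁ distinct basis elements. -/
theorem IsFull.ball_injOn (hS : IsFull S) {s : Set OmegaOne} (hr : ∀ ξ, 0 < r ξ)
    (hr₁ : ∀ ξ, r ξ < 1) (hinj : Function.Injective r) (hs : ∀ ξ ∈ s, (S (center ξ)).1 = 0 ∧ G ξ = ∅) :
    Set.InjOn (ball d F S center G r) s := by
  have key : ∀ ξ ∈ s, ∀ η ∈ s, ball d F S center G r ξ = ball d F S center G r η →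
      ¬ r ξ < r η := by
    intro ξ hξ η hη h hlt
    obtain ⟨x, hx⟩ := hS.exists_fst_eq (d := d) (F := F) ⟨r ξ, (hr ξ).le, (hr₁ ξ).le⟩
    have hv : ∀ ζ ∈ s, radial (G ζ) (embed d F (S (center ζ))) x.1 = r ξ := by
      intro ζ hζ
      have hdist : dist (⟨r ξ, (hr ξ).le, (hr₁ ξ).le⟩ : unitInterval) 0 = r ξ := by
        rw [Subtype.dist_eq]
        simp [abs_of_pos (hr ξ)]
      simp only [radial, (hs ζ hζ).2, Finset.sum_empty, add_zero, hx, embed, (hs ζ hζ).1, hdist]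
    have hmem : x ∈ ball d F S center G r η := (hv η hη).trans_lt hlt
    rw [← h] at hmem
    exact (lt_of_eq_of_lt (hv ξ hξ).symm hmem).false
  intro ξ hξ η hη h
  exact hinj (le_antisymm (not_lt.1 (key η hη ξ hξ h.symm)) (not_lt.1 (key ξ hξ η hη h)))

end Points

/-! ### Assembling the space -/

theorem theorem1p1 (hDiamond : Diamond) :
    ∃ (X : Type) (_ : TopologicalSpace X) (B : Set (Set X)),
      TopologicalSpace.IsTopologicalBasis B ∧
      -- regular (including Hausdorff), separable, connected, of cardinality `ℵ₁`
      T3Space X ∧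
      TopologicalSpace.SeparableSpace X ∧
      ConnectedSpace X ∧
      #X = ℵ₁ ∧
      -- the subspace `X \ O` is totally separated, hence totally disconnected
      (∀ O : Set X, IsOpen O → O.Nonempty →
        TotallySeparatedSpace ↥(Oᶜ) ∧ TotallyDisconnectedSpace ↥(Oᶜ)) ∧
      (∀ O : Set X, IsOpen O → O.Nonempty → ¬ O.Countable) ∧
      #B = ℵ₁ ∧
      -- every countable cover by basis elements has a finite subcover
      (∀ C : Set (Set X), C ⊆ B → C.Countable → ⋃₀ C = Set.univ →
        ∃ F : Set (Set X), F ⊆ C ∧ F.Finite ∧ ⋃₀ F = Set.univ) ∧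
      -- decreasing sequences of basis elements have a common point
      (∀ b : ℕ → Set X, (∀ n, b n ∈ B) → Antitone b → (⋂ n, b n).Nonempty) ∧
      StronglyChoquet X := by
  have hCH := hDiamond.continuum_eq
  obtain ⟨g, hg⟩ := exists_bookkeeping hCH
  obtain ⟨e⟩ : #OmegaOne ≤ #(Set ℕ) := by
    simpa [mk_omegaOne] using Cardinal.aleph_one_le_continuum
  let S := PointIndex.code e g
  let D : Set PointIndex := Set.range Sum.inl
  let d := fun α => S (Sum.inl (g α).2.2.1)
  let F := fun α => (g α).2.2.2
  have hS : IsFull S := PointIndex.isFull_code e g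
  have hDc : D.Countable := Set.countable_range _
  have hD : Dense (S '' D) := PointIndex.dense_code e.injective g
  have hsep : ∀ p q, p ≠ q → ∀ n ∈ D, ∀ G : Finset OmegaOne, ∃ α, d α = S n ∧ F α = G ∧
      (∀ i ∈ G, i < α) ∧ (S p).2 α = true ∧ (S q).2 α = false := by
    rintro p q hpq _ ⟨n, rfl⟩ G
    obtain ⟨α, hα, hlt, hp, hq⟩ := PointIndex.exists_separating e hg hpq n G
    exact ⟨α, by simp only [d, hα], by simp only [F, hα], hlt, hp, hq⟩
  -- The factor `ℕ` bounds the radius, to get arbitrarily small balls; the factor `OmegaOne` repeats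
  -- each ball datum ℵ₁ times, to get ℵ₁ different radii.
  have hcard : #OmegaOne = #(PointIndex × Finset OmegaOne × ℕ × OmegaOne) := by
    have h : ℵ₀ ≤ (ℵ₁ : Cardinal.{0}) := Cardinal.aleph0_le_aleph 1
    simp only [Cardinal.mk_prod, Cardinal.lift_id, Cardinal.mk_finset_of_infinite, mk_omegaOne,
      mk_pointIndex hCH, Cardinal.mk_nat, Cardinal.aleph0_mul_eq h, Cardinal.mul_eq_self h]
  obtain ⟨E⟩ := Cardinal.eq.1 hcard
  let center := fun ξ => (E ξ).1
  let G := fun ξ => (E ξ).2.1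
  obtain ⟨r, hr⟩ := exists_radii
    (fun ξ (x : points d F S) => radial (G ξ) (embed d F (S (center ξ))) x.1)
    (δ := fun ξ => 1 / ((E ξ).2.2.1 + 1)) (fun ξ => Nat.one_div_pos_of_nat)
  have hr₀ : ∀ ξ, 0 < r ξ := fun ξ => (hr ξ).1.1
  have hr₁ : ∀ ξ, r ξ < 1 := fun ξ => (hr ξ).1.2.trans_le (by
    rw [div_le_one (Nat.cast_add_one_pos _)]
    simp)
  have hinj : Function.Injective r := by
    intro ξ η h
    rcases lt_trichotomy ξ η with hlt | heq | hlt
    · exact absurd h.symm ((hr η).2 ξ hlt).1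
    · exact heq
    · exact absurd h ((hr ξ).2 η hlt).1
  have hbasis := isTopologicalBasis_range_ball (d := d) (F := F) (S := S) (center := center) (G := G)
    hr₀ fun p H ε hε => by
      obtain ⟨k, hk⟩ := exists_nat_one_div_lt hε
      refine ⟨E.symm (p, H, k, Classical.arbitrary _), by simp [center], by simp [G], ?_⟩
      refine (hr _).1.2.trans ?_
      simpa using hk
  have hanti := fun b => hS.iInter_nonempty_of_antitone (d := d) (F := F) (center := center) (G := G)
    hr₀ (fun ξ η hη => ((hr ξ).2 η hη).2) (b := b)
  have hconn := hS.connectedSpace_points (d := d) (F := F) hDc hD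
  refine ⟨points d F S, inferInstance, _, hbasis, inferInstance, separableSpace_points hDc hD,
    hconn, hS.mk_points (mk_pointIndex hCH), fun O hO hne => ?_,
    fun O hO hne => hS.not_countable_of_isOpen hO hne, ?_,
    fun C hCB hC hcov => hS.exists_finite_subcover hCB hC hcov, hanti, hbasis.stronglyChoquet hanti⟩
  · have := totallySeparatedSpace_compl hD hsep hO hne
    exact ⟨this, inferInstance⟩
  · refine le_antisymm (mk_omegaOne ▸ Cardinal.mk_range_le) ?_
    obtain ⟨p, hp, -⟩ := hS (Classical.arbitrary _) (0, fun _ => false)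
    let ξ : OmegaOne → OmegaOne := fun i => E.symm (p, ∅, 0, i)
    have hξ : Set.InjOn (ball d F S center G r) (Set.range ξ) := by
      refine hS.ball_injOn hr₀ hr₁ hinj ?_
      rintro _ ⟨i, rfl⟩
      simpa [center, G, ξ] using hp
    rw [← mk_omegaOne]
    refine Cardinal.mk_le_of_injective
      (f := fun i => (⟨ball d F S center G r (ξ i), ξ i, rfl⟩ : Set.range _)) fun i j h => ?_
    have := hξ ⟨i, rfl⟩ ⟨j, rfl⟩ (congrArg Subtype.val h)
    simpa [ξ] using this
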